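/- Let $m,k\in\mathbb N$ with $k\le m+1$, let $U\subset\mathbb R^{m+1}$ be open, and let $g=(g_1,\dots,g_k):U\to\mathbb R^k$ be continuous, each $g_i$ being an algebraic function on $U$; that is, for each $i$ there is an irreducible non-zero polynomial $p_i$ in $m+2$ variables with real coefficients such that $p_i(x,g_i(x))=0$ for all $x\in U$. Let $J_g(x)=\left(\partial g_i/\partial x_j(x)\right)_{i,j}$ denote the Jacobian matrix of $g$ at a point $x$ at which $g$ is differentiable. For a set $V$ of functions $\mathbb R^k\to\mathbb R$, say that $g$ is only trivially annihilated in $V$ if the only $H\in V$ with $H(g(x))=0$ for all $x\in U$ is $H=0$. Then each of the following three statements 1. $g_1,\dots,g_k$ are algebraically independent over $\mathbb R$, i.e. there is no non-zero polynomial $P\in\mathbb R[y_1,\dots,y_k]$ with $P(g_1(x),\dots,g_k(x))=0$ for all $x\in U$; 2. $g$ is only trivially annihilated in the set of polynomial functions $\mathbb R^k\to\mathbb R$; 3. $g$ is only trivially annihilated in the set of algebraic functions $\mathbb R^k\to\mathbb R$; holds if and only if there is a point $x\in U$ at which $g$ is differentiable and $\operatorname{rank}J_g(x)=k$. -/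

import Mathlib

/-- `f`, restricted to `U ⊆ ℝⁿ`, is an algebraic function: there is an irreducible
(in particular non-zero) real polynomial `p` in `n + 1` variables that vanishes on the graph of `f`
over `U`. Variable `0` of `p` stands for the value `f x`, variables `1, …, n` for the coordinates
of `x`. -/
def IsAlgebraicFunOn {n : ℕ} (f : (Fin n → ℝ) → ℝ) (U : Set (Fin n → ℝ)) : Prop :=
  ∃ p : MvPolynomial (Fin (n + 1)) ℝ, Irreducible p ∧
    ∀ x ∈ U, MvPolynomial.eval (Fin.cons (f x) x : Fin (n + 1) → ℝ) p = 0

/-- The set of polynomial functions `ℝᵏ → ℝ`. -/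
def polynomialFuns (k : ℕ) : Set ((Fin k → ℝ) → ℝ) :=
  {H | ∃ P : MvPolynomial (Fin k) ℝ, ∀ y, H y = MvPolynomial.eval y P}

/-- The set of algebraic functions `ℝᵏ → ℝ`. -/
def algebraicFuns (k : ℕ) : Set ((Fin k → ℝ) → ℝ) :=
  {H | IsAlgebraicFunOn H Set.univ}

/-- `g : U → ℝᵏ` is only trivially annihilated in the set `V` of functions `ℝᵏ → ℝ`: the only
`H ∈ V` with `H (g x) = 0` for all `x ∈ U` is the zero function. -/
def OnlyTriviallyAnnihilatedIn {n k : ℕ} (V : Set ((Fin k → ℝ) → ℝ))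
    (g : (Fin n → ℝ) → (Fin k → ℝ)) (U : Set (Fin n → ℝ)) : Prop :=
  ∀ H ∈ V, (∀ x ∈ U, H (g x) = 0) → H = 0

/-- The Jacobian matrix `J_g(x)`, with entries `∂gᵢ/∂xⱼ (x)`. -/
noncomputable def jacobianMatrix {n k : ℕ} (g : (Fin n → ℝ) → (Fin k → ℝ)) (x : Fin n → ℝ) :
    Matrix (Fin k) (Fin n) ℝ :=
  Matrix.of fun i j => fderiv ℝ (fun y => g y i) x (Pi.single j 1)

/-! All three conditions say that no non-zero polynomial vanishes along `g` on `U`; for algebraic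
functions this uses `IsAlgebraicFunOn.exists_polynomial_of_ne_zero`. If the rank is `k` at a point,
rescaling near it shows that the lowest homogeneous part of an annihilating polynomial, recentred
there, vanishes on all of `ℝᵏ` (`eq_zero_of_eval_eq_zero_of_surjective`).

For the converse, functions on `U` do not form a field, so one passes to the ultraproduct along an
ultrafilter that contains all dense open sets and preserves the independence of `g`
(`exists_ultrafilter_generic`). There the `gᵢ` extend by coordinates to a family of at most `n = m +
1` elements over which every coordinate is algebraic. The simple-root relations hold in a
neighbourhood of almost every point. Differentiating them shows that `g` is differentiable there and
that the differentials of the family have no common kernel. Being at most `n` forms on `ℝⁿ`, they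
are linearly independent, so the derivative of `g` is surjective (`exists_surjective_fderiv`). -/

section

open Filter Topology Set

/-! ### Simple roots and transcendence bases -/

/-- An element algebraic over `ℝ[b]` is a simple root of a polynomial with coefficients in `ℝ[b]`. -/
theorem exists_eval₂_eq_zero_derivative_ne_zero {F ι : Type*} [Field F] [Algebra ℝ F]
    {b : ι → F} {a : F} (h : IsAlgebraic (Algebra.adjoin ℝ (range b)) a) :
    ∃ Q : Polynomial (MvPolynomial ι ℝ),
      Q.eval₂ (MvPolynomial.aeval b : MvPolynomial ι ℝ →ₐ[ℝ] F).toRingHom a = 0 ∧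
      Q.derivative.eval₂ (MvPolynomial.aeval b : MvPolynomial ι ℝ →ₐ[ℝ] F).toRingHom a ≠ 0 := by
  have : CharZero F := charZero_of_injective_algebraMap (algebraMap ℝ F).injective
  set φ : MvPolynomial ι ℝ →+* F := (MvPolynomial.aeval b : MvPolynomial ι ℝ →ₐ[ℝ] F).toRingHom
    with hφ
  have key : ∃ Q : Polynomial (MvPolynomial ι ℝ), Q.map φ ≠ 0 ∧ Q.eval₂ φ a = 0 := by
    obtain ⟨q, hq0, hq⟩ := h
    let ρ : MvPolynomial ι ℝ →ₐ[ℝ] Algebra.adjoin ℝ (range b) :=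
      (MvPolynomial.aeval b).codRestrict _ fun P => by
        rw [Algebra.adjoin_range_eq_range_aeval]
        exact ⟨P, rfl⟩
    have hρ : Function.Surjective ρ.toRingHom := by
      rintro ⟨y, hy⟩
      have hy' := hy
      rw [Algebra.adjoin_range_eq_range_aeval] at hy'
      obtain ⟨P, hP⟩ := hy'
      exact ⟨P, Subtype.ext hP⟩
    obtain ⟨Q, rfl⟩ := Polynomial.map_surjective _ hρ q
    have hcomp : (algebraMap (Algebra.adjoin ℝ (range b)) F).comp ρ.toRingHom = φ := rfl
    refine ⟨Q, fun h0 => hq0 ?_, ?_⟩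
    · rw [← hcomp, ← Polynomial.map_map] at h0
      exact (Polynomial.map_eq_zero_iff Subtype.val_injective).mp h0
    · rwa [Polynomial.aeval_def, Polynomial.eval₂_map, hcomp] at hq
  classical
  -- The degree is taken after `φ`, which may kill leading coefficients. For `Q` of least degree, a
  -- derivative vanishing at `a` would be a smaller witness, non-zero by characteristic zero.
  let S : ℕ → Prop := fun d => ∃ Q : Polynomial (MvPolynomial ι ℝ),
    Q.map φ ≠ 0 ∧ Q.eval₂ φ a = 0 ∧ (Q.map φ).natDegree = d
  have hS : ∃ d, S d := by
    obtain ⟨Q, h1, h2⟩ := key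
    exact ⟨_, Q, h1, h2, rfl⟩
  obtain ⟨Q, h1, h2, h3⟩ := Nat.find_spec hS
  refine ⟨Q, h2, fun h4 => ?_⟩
  have hdeg : (Q.map φ).natDegree ≠ 0 := by
    intro h0
    rw [Polynomial.natDegree_eq_zero] at h0
    obtain ⟨c, hc⟩ := h0
    rw [← Polynomial.eval_map, ← hc, Polynomial.eval_C] at h2
    exact h1 (by rw [← hc, h2, Polynomial.C_0])
  have hlt : (Q.derivative.map φ).natDegree < (Q.map φ).natDegree := by
    rw [← Polynomial.derivative_map]
    exact Polynomial.natDegree_derivative_lt hdeg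
  refine Nat.find_min hS (h3 ▸ hlt) ⟨Q.derivative, ?_, h4, rfl⟩
  rw [← Polynomial.derivative_map]
  intro h5
  exact hdeg (Polynomial.derivative_eq_zero.mp h5)

/-- If `g` is independent and algebraic over `ℝ[x]`, then `g` extends by members of `x` to a
family of at most `n` elements over which all of `x` is algebraic. -/
theorem exists_transcendenceBasis_sum {F : Type*} [Field F] [Algebra ℝ F] {n k : ℕ}
    {x : Fin n → F} {g : Fin k → F} (hg : AlgebraicIndependent ℝ g)
    (hgx : ∀ i, IsAlgebraic (Algebra.adjoin ℝ (range x)) (g i)) :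
    ∃ J : Set (Fin k ⊕ Fin n), (∀ i, Sum.inl i ∈ J) ∧ J.encard ≤ n ∧
      ∀ l, IsAlgebraic (Algebra.adjoin ℝ (range fun j : J => Sum.elim g x j)) (x l) := by
  let M := AlgebraicIndependent.matroid ℝ F
  have hind : (M.comap (Sum.elim g x)).Indep (range Sum.inl) := by
    rw [Matroid.comap_indep_iff]
    constructor
    · rw [AlgebraicIndependent.matroid_indep_iff, ← range_comp, Sum.elim_comp_inl]
      exact hg.to_subtype_range
    · rintro _ ⟨i, rfl⟩ _ ⟨j, rfl⟩ hij
      exact congrArg _ (hg.injective hij)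
  obtain ⟨J, hJ, hsub⟩ := hind.exists_isBase_superset
  rw [Matroid.comap_isBase_iff] at hJ
  obtain ⟨hJ, hinj, -⟩ := hJ
  have hE : Sum.elim g x ⁻¹' M.E = univ := rfl
  rw [hE, image_univ] at hJ
  have hr : range (fun j : J => Sum.elim g x j) = Sum.elim g x '' J := by
    rw [← image_eq_range]
  refine ⟨J, fun i => hsub ⟨i, rfl⟩, ?_, fun l => ?_⟩
  · rw [← hinj.encard_image, hJ.encard_eq_eRk]
    -- Everything is algebraic over `x`, so the rank is at most `n`.
    have hcl : range (Sum.elim g x) ⊆ M.closure (range x) := by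
      rw [AlgebraicIndependent.matroid_closure_eq]
      rintro _ ⟨i | i, rfl⟩
      · exact hgx i
      · exact isAlgebraic_algebraMap
          (⟨x i, Algebra.subset_adjoin ⟨i, rfl⟩⟩ : Algebra.adjoin ℝ (range x))
    calc M.eRk (range (Sum.elim g x)) ≤ M.eRk (M.closure (range x)) := M.eRk_mono hcl
      _ = M.eRk (range x) := M.eRk_closure_eq _
      _ ≤ (range x).encard := M.eRk_le_encard _
      _ ≤ n := by
        rw [← image_univ]
        refine (encard_image_le _ _).trans ?_
        simp
  · rw [hr]
    exact (AlgebraicIndependent.matroid_isBasis_iff.mp hJ).2.2 _ ⟨Sum.inr l, rfl⟩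

/-! ### Generic ultrafilters and their ultraproduct fields -/

/-- The ultraproduct of copies of `ℝ` is a field. -/
theorem exists_field_algHom_eventually {X : Type} (u : Ultrafilter X) :
    ∃ (F : Type) (_ : Field F) (_ : Algebra ℝ F) (φ : (X → ℝ) →ₐ[ℝ] F),
      ∀ f, φ f = 0 ↔ ∀ᶠ x in u, f x = 0 := by
  let ψ : (X → ℝ) →+* Germ (u : Filter X) ℝ := Germ.coeRingHom _
  let _ : Algebra ℝ (Germ (u : Filter X) ℝ) := (ψ.comp (algebraMap ℝ (X → ℝ))).toAlgebra
  refine ⟨Germ (u : Filter X) ℝ, inferInstance, inferInstance,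
    { ψ with commutes' := fun r => rfl }, fun f => ?_⟩
  exact Germ.coe_eq

/-- An ultrafilter on `U` that contains every dense open set and avoids every relation of `g`. -/
theorem exists_ultrafilter_generic {n k : ℕ} {U : Set (Fin n → ℝ)} (hU : IsOpen U)
    {g : (Fin n → ℝ) → (Fin k → ℝ)} (hcont : ContinuousOn g U)
    (hg : ∀ P : MvPolynomial (Fin k) ℝ, (∀ x ∈ U, MvPolynomial.eval (g x) P = 0) → P = 0) :
    ∃ u : Ultrafilter (Fin n → ℝ), U ∈ u ∧ (∀ W, IsOpen W → Dense W → W ∈ u) ∧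
      ∀ P : MvPolynomial (Fin k) ℝ, P ≠ 0 → ∀ᶠ x in u, MvPolynomial.eval (g x) P ≠ 0 := by
  let f : Filter (Fin n → ℝ) :=
    { sets := {s | ∃ W, IsOpen W ∧ Dense W ∧ ∃ P : MvPolynomial (Fin k) ℝ, P ≠ 0 ∧
        ∀ x ∈ U, x ∈ W → MvPolynomial.eval (g x) P ≠ 0 → x ∈ s}
      univ_sets := ⟨univ, isOpen_univ, dense_univ, 1, one_ne_zero, fun _ _ _ _ => trivial⟩
      sets_of_superset := fun ⟨W, h1, h2, P, h3, h4⟩ hst =>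
        ⟨W, h1, h2, P, h3, fun x a b c => hst (h4 x a b c)⟩
      inter_sets := by
        rintro s t ⟨W, h1, h2, P, h3, h4⟩ ⟨W', h1', h2', P', h3', h4'⟩
        refine ⟨W ∩ W', h1.inter h1', h2.inter_of_isOpen_left h2' h1, P * P',
          mul_ne_zero h3 h3', fun x a b c => ?_⟩
        rw [map_mul] at c
        exact ⟨h4 x a b.1 (left_ne_zero_of_mul c), h4' x a b.2 (right_ne_zero_of_mul c)⟩ }
  have hne : f.NeBot := by
    rw [neBot_iff, Ne, ← empty_mem_iff_bot]
    rintro ⟨W, h1, h2, P, h3, h4⟩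
    refine h3 (hg P fun x hx => ?_)
    by_contra hPx
    have hc : ContinuousOn (fun y => MvPolynomial.eval (g y) P) U :=
      (MvPolynomial.continuous_eval P).comp_continuousOn hcont
    have ho := hc.isOpen_inter_preimage hU (isOpen_compl_singleton (x := (0 : ℝ)))
    obtain ⟨y, hy, hyW⟩ := h2.inter_open_nonempty _ ho ⟨x, hx, hPx⟩
    exact h4 y hy.1 hyW hy.2
  have hle := Ultrafilter.of_le f
  refine ⟨Ultrafilter.of f, hle ?_, fun W h1 h2 => hle ?_, fun P hP => ?_⟩
  · exact ⟨univ, isOpen_univ, dense_univ, 1, one_ne_zero, fun _ h _ _ => h⟩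
  · exact ⟨W, h1, h2, 1, one_ne_zero, fun _ _ h _ => h⟩
  · have hmem : {x | MvPolynomial.eval (g x) P ≠ 0} ∈ f :=
      ⟨univ, isOpen_univ, dense_univ, P, hP, fun _ _ _ h => h⟩
    exact hle hmem

/-- The zero set is relatively closed in `U`, so its boundary is negligible: `interior Z ∪ (closure
Z)ᶜ` is open and dense. -/
theorem eventually_eventually_nhds_eq_zero {X : Type*} [TopologicalSpace X] {u : Filter X}
    (hu : ∀ W, IsOpen W → Dense W → W ∈ u) {U : Set X} (hU : IsOpen U) (hUu : U ∈ u)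
    {h : X → ℝ} (hc : ContinuousOn h U) (h0 : ∀ᶠ x in u, h x = 0) :
    ∀ᶠ x in u, ∀ᶠ y in 𝓝 x, h y = 0 := by
  set Z : Set X := U ∩ h ⁻¹' {0} with hZ
  have hW : interior Z ∪ (closure Z)ᶜ ∈ u := by
    refine hu _ (isOpen_interior.union isClosed_closure.isOpen_compl) ?_
    rw [dense_iff_inter_open]
    rintro O hO ⟨y, hy⟩
    by_contra hempty
    rw [not_nonempty_iff_eq_empty, eq_empty_iff_forall_notMem] at hempty
    have hOcl : O ⊆ closure Z := fun z hz => by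
      by_contra hz'
      exact hempty z ⟨hz, Or.inr hz'⟩
    obtain ⟨z, hzO, hzZ⟩ := mem_closure_iff.mp (hOcl hy) O hO hy
    refine hempty z ⟨hzO, Or.inl ?_⟩
    rw [mem_interior]
    refine ⟨O ∩ U, fun w hw => ⟨hw.2, ?_⟩, hO.inter hU, hzO, hzZ.1⟩
    by_contra hw0
    have ho := hc.isOpen_inter_preimage hU (isOpen_compl_singleton (x := (0 : ℝ)))
    have hwm : w ∈ U ∩ h ⁻¹' {0}ᶜ := ⟨hw.2, hw0⟩
    obtain ⟨v, hv, hvZ⟩ := mem_closure_iff.mp (hOcl hw.1) _ ho hwm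
    exact hv.2 hvZ.2
  filter_upwards [hW, hUu, h0] with x hx hxU hx0
  rcases hx with hx | hx
  · filter_upwards [mem_interior_iff_mem_nhds.mp hx] with y hy using hy.2
  · have hxZ : x ∈ Z := ⟨hxU, hx0⟩
    exact absurd (subset_closure hxZ) hx

/-! ### Differentiating polynomial relations -/

/-- A polynomial expression in differentiable functions has derivative in the span of theirs. -/
theorem exists_mem_span_hasFDerivAt_eval {E ι : Type*} [NormedAddCommGroup E] [NormedSpace ℝ E]
    {β : ι → E → ℝ} {β' : ι → E →L[ℝ] ℝ} {x : E} (hβ : ∀ i, HasFDerivAt (β i) (β' i) x)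
    (P : MvPolynomial ι ℝ) :
    ∃ D ∈ Submodule.span ℝ (range β'),
      HasFDerivAt (fun y => MvPolynomial.eval (fun i => β i y) P) D x := by
  induction P using MvPolynomial.induction_on with
  | C a => exact ⟨0, zero_mem _, by simpa using hasFDerivAt_const a x⟩
  | add p q hp hq =>
    obtain ⟨D, hD, h⟩ := hp
    obtain ⟨D', hD', h'⟩ := hq
    exact ⟨D + D', add_mem hD hD', by simpa using h.fun_add h'⟩
  | mul_X p i hp =>
    obtain ⟨D, hD, h⟩ := hp
    refine ⟨_, ?_, by simpa using h.fun_mul (hβ i)⟩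
    exact add_mem (Submodule.smul_mem _ _ (Submodule.subset_span ⟨i, rfl⟩))
      (Submodule.smul_mem _ _ hD)

/-- Chain rule with the `α'` term split off: its coefficient is what a simple root makes non-zero,
and the remainder `D` matters only through vanishing on the common kernel of the `β'`. -/
theorem exists_mem_span_hasFDerivAt_eval₂ {E ι : Type*} [NormedAddCommGroup E] [NormedSpace ℝ E]
    {β : ι → E → ℝ} {β' : ι → E →L[ℝ] ℝ} {α : E → ℝ} {α' : E →L[ℝ] ℝ} {x : E}
    (hβ : ∀ i, HasFDerivAt (β i) (β' i) x) (hα : HasFDerivAt α α' x)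
    (Q : Polynomial (MvPolynomial ι ℝ)) :
    ∃ D ∈ Submodule.span ℝ (range β'),
      HasFDerivAt (fun y => Q.eval₂ (MvPolynomial.eval fun i => β i y) (α y))
        (Q.derivative.eval₂ (MvPolynomial.eval fun i => β i x) (α x) • α' + D) x := by
  induction Q using Polynomial.induction_on' with
  | add p q hp hq =>
    obtain ⟨D, hD, h⟩ := hp
    obtain ⟨D', hD', h'⟩ := hq
    refine ⟨D + D', add_mem hD hD', ?_⟩
    simp only [Polynomial.eval₂_add, Polynomial.derivative_add]
    refine (h.fun_add h').congr_fderiv ?_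
    module
  | monomial n P =>
    obtain ⟨D, hD, h⟩ := exists_mem_span_hasFDerivAt_eval hβ P
    refine ⟨α x ^ n • D, Submodule.smul_mem _ _ hD, ?_⟩
    simp only [Polynomial.eval₂_monomial, Polynomial.derivative_monomial]
    refine (h.fun_mul (hα.pow n)).congr_fderiv ?_
    simp only [map_mul, map_natCast, nsmul_eq_mul]
    module

theorem apply_eq_zero_of_mem_span {E ι : Type*} [NormedAddCommGroup E] [NormedSpace ℝ E]
    {β' : ι → E →L[ℝ] ℝ} {v : E} (hv : ∀ i, β' i v = 0) {D : E →L[ℝ] ℝ}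
    (hD : D ∈ Submodule.span ℝ (range β')) : D v = 0 := by
  induction hD using Submodule.span_induction with
  | mem D h => obtain ⟨i, rfl⟩ := h; exact hv i
  | zero => rfl
  | add D D' _ _ h h' => simp [h, h']
  | smul c D _ h => simp [h]

/-- A continuous solution of an implicit equation is differentiable if the partial derivative
with respect to the unknown does not vanish. -/
theorem differentiableAt_of_implicit {E : Type*} [NormedAddCommGroup E] [NormedSpace ℝ E]
    {f : ℝ × E → ℝ} {L : ℝ × E →L[ℝ] ℝ} {h : E → ℝ} {x : E} (hc : ContinuousAt h x)
    (hf : HasFDerivAt f L (h x, x)) (hL : L (1, 0) ≠ 0) (h0 : ∀ᶠ y in 𝓝 x, f (h y, y) = 0) :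
    DifferentiableAt ℝ h x := by
  set a := L (1, 0) with ha
  set M : E →L[ℝ] ℝ := a⁻¹ • L.comp (ContinuousLinearMap.inr ℝ ℝ E) with hM
  have hLM : ∀ t w, L (t, w) = a * (t + M w) := fun t w => by
    have : ((t, w) : ℝ × E) = t • (1, 0) + (0, w) := by simp
    rw [this, map_add, map_smul, ← ha]
    simp only [hM, smul_eq_mul, smul_apply, ContinuousLinearMap.comp_apply,
      ContinuousLinearMap.inr_apply]
    field_simp
  have ht : Tendsto (fun y => (h y, y)) (𝓝 x) (𝓝 (h x, x)) := hc.prodMk continuousAt_id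
  have hx0 : f (h x, x) = 0 := h0.self_of_nhds
  have key : (fun y => h y - h x + M (y - x)) =o[𝓝 x] fun y => ((h y, y) - (h x, x) : ℝ × E) := by
    have h1 := (hf.isLittleO.comp_tendsto ht).const_mul_left (-a⁻¹)
    refine h1.congr' ?_ EventuallyEq.rfl
    filter_upwards [h0] with y hy
    simp only [Function.comp_apply, hy, hx0, Prod.mk_sub_mk, hLM]
    field_simp
    ring
  have hO : (fun y => ((h y, y) - (h x, x) : ℝ × E)) =O[𝓝 x] fun y => y - x := by
    -- With error at most half the maximum, a dominant `h y - h x` is absorbed on the left, giving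
    -- `2‖M‖`; otherwise the constant `1` suffices.
    refine Asymptotics.IsBigO.of_bound (2 * ‖M‖ + 1) ?_
    filter_upwards [key.bound (half_pos one_pos)] with y hy
    rw [Prod.mk_sub_mk, Prod.norm_mk] at hy ⊢
    have h2 : ‖h y - h x‖ ≤ ‖h y - h x + M (y - x)‖ + ‖M (y - x)‖ := by
      simpa using norm_sub_le (h y - h x + M (y - x)) (M (y - x))
    have h3 := M.le_opNorm (y - x)
    have h4 := norm_nonneg (y - x)
    have h5 : 0 ≤ ‖M‖ * ‖y - x‖ := by positivity
    rcases max_cases ‖h y - h x‖ ‖y - x‖ with ⟨h6, -⟩ | ⟨h6, -⟩ <;> rw [h6] at hy ⊢ <;> nlinarith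
  have : HasFDerivAt h (-M) x := by
    rw [hasFDerivAt_iff_isLittleO]
    refine (key.trans_isBigO hO).congr_left fun y => ?_
    rw [neg_apply, sub_neg_eq_add]
  exact this.differentiableAt

/-! ### Full rank forces independence -/

theorem MvPolynomial.IsHomogeneous.eval_smul {σ : Type*} {p : MvPolynomial σ ℝ} {d : ℕ}
    (hp : p.IsHomogeneous d) (t : ℝ) (v : σ → ℝ) :
    MvPolynomial.eval (t • v) p = t ^ d * MvPolynomial.eval v p := by
  rw [MvPolynomial.eval_eq, MvPolynomial.eval_eq, Finset.mul_sum]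
  refine Finset.sum_congr rfl fun m hm => ?_
  have hd : m.degree = d := by
    rw [Finsupp.degree_eq_weight_one]
    exact hp (MvPolynomial.mem_support_iff.mp hm)
  simp only [Pi.smul_apply, smul_eq_mul, mul_pow, Finset.prod_mul_distrib,
    Finset.prod_pow_eq_pow_sum]
  rw [← hd, Finsupp.degree_apply]
  ring

/-- Lowest-order term argument: a polynomial vanishing along a map that is differentiable at a
point with surjective derivative is zero. -/
theorem eq_zero_of_eval_eq_zero_of_surjective {E : Type*} [NormedAddCommGroup E] [NormedSpace ℝ E]
    {k : ℕ} {g : E → Fin k → ℝ} {g' : E →L[ℝ] Fin k → ℝ} {x : E} (hg : HasFDerivAt g g' x)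
    (hs : Function.Surjective g') {P : MvPolynomial (Fin k) ℝ}
    (hP : ∀ᶠ y in 𝓝 x, MvPolynomial.eval (g y) P = 0) : P = 0 := by
  classical
  let Q : MvPolynomial (Fin k) ℝ :=
    MvPolynomial.bind₁ (fun i => MvPolynomial.X i + MvPolynomial.C (g x i)) P
  have hQ : ∀ v, MvPolynomial.eval v Q = MvPolynomial.eval (v + g x) P := fun v => by
    have := MvPolynomial.eval₂Hom_bind₁ (RingHom.id ℝ) v
      (fun i => MvPolynomial.X i + MvPolynomial.C (g x i)) P
    refine this.trans ?_
    have h2 : (fun i => (MvPolynomial.eval₂Hom (RingHom.id ℝ) v)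
      (MvPolynomial.X i + MvPolynomial.C (g x i))) = v + g x := by ext i; simp
    rw [h2]
    rfl
  by_contra hP0
  have hQ0 : Q ≠ 0 := fun h => hP0 <| MvPolynomial.funext fun v => by
    have := hQ (v - g x)
    rw [h, sub_add_cancel] at this
    simpa using this.symm
  have hex : ∃ d, Q.homogeneousComponent d ≠ 0 := by
    by_contra! hall
    exact hQ0 (by rw [← MvPolynomial.sum_homogeneousComponent Q]; simp [hall])
  obtain ⟨d, hd, hmin⟩ : ∃ d, Q.homogeneousComponent d ≠ 0 ∧
      ∀ j < d, Q.homogeneousComponent j = 0 :=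
    ⟨Nat.find hex, Nat.find_spec hex, fun j hj => not_not.mp (Nat.find_min hex hj)⟩
  refine hd (MvPolynomial.funext fun v => ?_)
  obtain ⟨w, rfl⟩ := hs v
  -- This is `Q (t • v) / t ^ d`, extended continuously to `t = 0`, where only the lowest component
  -- survives.
  let R : ℝ × (Fin k → ℝ) → ℝ := fun z => ∑ j ∈ Finset.range (Q.totalDegree + 1),
    if j < d then 0 else z.1 ^ (j - d) * MvPolynomial.eval z.2 (Q.homogeneousComponent j)
  have hR : ∀ t v, t ^ d * R (t, v) = MvPolynomial.eval (t • v) Q := fun t v => by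
    conv_rhs => rw [← MvPolynomial.sum_homogeneousComponent Q]
    rw [map_sum, Finset.mul_sum]
    refine Finset.sum_congr rfl fun j _ => ?_
    rw [(Q.homogeneousComponent_isHomogeneous j).eval_smul]
    split_ifs with hj
    · simp [hmin j hj]
    · rw [← mul_assoc, ← pow_add, Nat.add_sub_cancel' (not_lt.mp hj)]
  have hRc : Continuous R := by
    refine continuous_finsetSum _ fun j _ => ?_
    split_ifs
    · exact continuous_const
    · exact (continuous_fst.pow _).mul ((MvPolynomial.continuous_eval _).comp continuous_snd)
  have hR0 : ∀ v, R (0, v) = MvPolynomial.eval v (Q.homogeneousComponent d) := fun v => by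
    have hle : d ∈ Finset.range (Q.totalDegree + 1) := by
      rw [Finset.mem_range]
      by_contra! hlt
      exact hd (MvPolynomial.homogeneousComponent_eq_zero _ _ (by lia))
    refine (Finset.sum_eq_single_of_mem d hle fun j _ hj => ?_).trans (by simp)
    split_ifs with hjd
    · rfl
    · rw [zero_pow (by lia), zero_mul]
  have hslope := (hg.hasLineDerivAt w).tendsto_slope_zero
  have hlim : Tendsto (fun t : ℝ => R (t, t⁻¹ • (g (x + t • w) - g x))) (𝓝[≠] 0)
      (𝓝 (R (0, g' w))) :=
    (hRc.tendsto _).comp ((tendsto_id.mono_left nhdsWithin_le_nhds).prodMk_nhds hslope)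
  have hline : Tendsto (fun t : ℝ => x + t • w) (𝓝[≠] 0) (𝓝 x) := by
    have : Continuous fun t : ℝ => x + t • w := by fun_prop
    simpa using (this.tendsto 0).mono_left nhdsWithin_le_nhds
  have hzero : (fun t : ℝ => R (t, t⁻¹ • (g (x + t • w) - g x))) =ᶠ[𝓝[≠] 0] fun _ => 0 := by
    filter_upwards [hline.eventually hP, self_mem_nhdsWithin] with t ht ht0
    have h := hR t (t⁻¹ • (g (x + t • w) - g x))
    rw [smul_inv_smul₀ ht0, hQ, sub_add_cancel, ht] at h
    exact (mul_eq_zero.mp h).resolve_left (pow_ne_zero _ ht0)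
  rw [← hR0, map_zero]
  exact tendsto_nhds_unique (hlim.congr' hzero) tendsto_const_nhds

theorem fderiv_apply_eq_jacobianMatrix_mulVec {n k : ℕ} {g : (Fin n → ℝ) → (Fin k → ℝ)}
    {x : Fin n → ℝ} (hg : DifferentiableAt ℝ g x) (v : Fin n → ℝ) :
    (jacobianMatrix g x).mulVec v = fderiv ℝ g x v := by
  ext i
  have hi : fderiv ℝ (fun y => g y i) x = (ContinuousLinearMap.proj i).comp (fderiv ℝ g x) :=
    (hasFDerivAt_pi'.mp hg.hasFDerivAt i).fderiv
  conv_rhs => rw [pi_eq_sum_univ' v]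
  simp [Matrix.mulVec, dotProduct, jacobianMatrix, hi, map_sum, mul_comm]

theorem jacobianMatrix_rank_eq_iff {n k : ℕ} {g : (Fin n → ℝ) → (Fin k → ℝ)}
    {x : Fin n → ℝ} (hg : DifferentiableAt ℝ g x) :
    (jacobianMatrix g x).rank = k ↔ Function.Surjective (fderiv ℝ g x) := by
  have h : Function.Surjective (fderiv ℝ g x) ↔
      Function.Surjective (jacobianMatrix g x).mulVecLin := by
    refine forall_congr' fun c => exists_congr fun v => ?_
    rw [Matrix.mulVecLin_apply, fderiv_apply_eq_jacobianMatrix_mulVec hg]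
  rw [h, ← LinearMap.range_eq_top, Matrix.rank]
  constructor
  · intro hr
    exact Submodule.eq_top_of_finrank_eq (by rw [hr, Module.finrank_fin_fun])
  · intro hr
    rw [hr, finrank_top, Module.finrank_fin_fun]

/-! ### Independence forces full rank -/

theorem map_polynomial_eval₂_pi {X F ι : Type*} [Field F] [Algebra ℝ F] (φ : (X → ℝ) →ₐ[ℝ] F)
    (α : X → ℝ) (β : ι → X → ℝ) (Q : Polynomial (MvPolynomial ι ℝ)) :
    φ (fun y => Q.eval₂ (MvPolynomial.eval fun i => β i y) (α y)) =
      Q.eval₂ (MvPolynomial.aeval (fun i => φ (β i)) : MvPolynomial ι ℝ →ₐ[ℝ] F).toRingHom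
        (φ α) := by
  have h1 : (fun y => Q.eval₂ (MvPolynomial.eval fun i => β i y) (α y)) =
      Q.eval₂ (MvPolynomial.aeval β : MvPolynomial ι ℝ →ₐ[ℝ] (X → ℝ)).toRingHom α := by
    ext y
    have := Polynomial.hom_eval₂ Q
      (MvPolynomial.aeval β : MvPolynomial ι ℝ →ₐ[ℝ] (X → ℝ)).toRingHom (Pi.evalRingHom _ y) α
    refine Eq.trans ?_ this.symm
    congr 1
    ext i <;> simp
  have h2 := Polynomial.hom_eval₂ Q
    (MvPolynomial.aeval β : MvPolynomial ι ℝ →ₐ[ℝ] (X → ℝ)).toRingHom φ.toRingHom α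
  rw [h1]
  refine h2.trans ?_
  congr 1
  ext i <;> simp

theorem map_mvPolynomial_eval_pi {X F ι : Type*} [Field F] [Algebra ℝ F] (φ : (X → ℝ) →ₐ[ℝ] F)
    (β : ι → X → ℝ) (P : MvPolynomial ι ℝ) :
    φ (fun y => MvPolynomial.eval (fun i => β i y) P) =
      MvPolynomial.aeval (fun i => φ (β i)) P := by
  simpa using map_polynomial_eval₂_pi φ 0 β (Polynomial.C P)

/-- The map `φ` translates a simple-root relation in `F` into one between values at almost every
point; continuity and genericity spread the equation to a neighbourhood. -/
theorem exists_eventually_implicit_equation {X : Type} [TopologicalSpace X] {u : Ultrafilter X}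
    (hu : ∀ W, IsOpen W → Dense W → W ∈ u) {U : Set X} (hU : IsOpen U) (hUu : U ∈ u)
    {F ι : Type*} [Field F] [Algebra ℝ F] {φ : (X → ℝ) →ₐ[ℝ] F}
    (hφ : ∀ f, φ f = 0 ↔ ∀ᶠ x in u, f x = 0) {α : X → ℝ} {β : ι → X → ℝ}
    (hα : ContinuousOn α U) (hβ : ∀ i, ContinuousOn (β i) U)
    (h : IsAlgebraic (Algebra.adjoin ℝ (range fun i => φ (β i))) (φ α)) :
    ∃ Q : Polynomial (MvPolynomial ι ℝ), ∀ᶠ x in u,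
      (∀ᶠ y in 𝓝 x, Q.eval₂ (MvPolynomial.eval fun i => β i y) (α y) = 0) ∧
      Q.derivative.eval₂ (MvPolynomial.eval fun i => β i x) (α x) ≠ 0 := by
  obtain ⟨Q, h0, h1⟩ := exists_eval₂_eq_zero_derivative_ne_zero h
  rw [← map_polynomial_eval₂_pi, hφ] at h0
  rw [← map_polynomial_eval₂_pi, Ne, hφ, ← Ultrafilter.eventually_not] at h1
  refine ⟨Q, (eventually_eventually_nhds_eq_zero hu hU hUu ?_ h0).and h1⟩
  have hβ' : ContinuousOn (fun y i => β i y) U := continuousOn_pi.mpr hβ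
  simp only [Polynomial.eval₂_eq_sum_range]
  exact continuousOn_finsetSum _ fun j _ =>
    ((MvPolynomial.continuous_eval _).comp_continuousOn hβ').mul (hα.pow _)

/-- Algebraically independent continuous algebraic functions have a surjective derivative
somewhere. -/
theorem exists_surjective_fderiv {n k : ℕ} {U : Set (Fin n → ℝ)} (hU : IsOpen U)
    {g : (Fin n → ℝ) → (Fin k → ℝ)} (hcont : ContinuousOn g U)
    (halg : ∀ i, IsAlgebraicFunOn (fun x => g x i) U)
    (hg : ∀ P : MvPolynomial (Fin k) ℝ, (∀ x ∈ U, MvPolynomial.eval (g x) P = 0) → P = 0) :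
    ∃ x ∈ U, DifferentiableAt ℝ g x ∧ Function.Surjective (fderiv ℝ g x) := by
  obtain ⟨u, hUu, hu, hgu⟩ := exists_ultrafilter_generic hU hcont hg
  obtain ⟨F, _, _, φ, hφ⟩ := exists_field_algHom_eventually u
  let G : Fin k → (Fin n → ℝ) → ℝ := fun i y => g y i
  let X : Fin n → (Fin n → ℝ) → ℝ := fun l y => y l
  have hGc : ∀ i, ContinuousOn (G i) U := fun i => continuousOn_pi.mp hcont i
  have hXc : ∀ l, ContinuousOn (X l) U := fun l => (continuous_apply l).continuousOn
  have hGind : AlgebraicIndependent ℝ fun i => φ (G i) := by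
    rw [algebraicIndependent_iff]
    intro P hP
    rw [← map_mvPolynomial_eval_pi, hφ] at hP
    by_contra hP0
    obtain ⟨y, hy, hy'⟩ := (hP.and (hgu P hP0)).exists
    exact hy' hy
  have hXind : AlgebraicIndependent ℝ fun l => φ (X l) := by
    rw [algebraicIndependent_iff]
    intro P hP
    rw [← map_mvPolynomial_eval_pi, hφ] at hP
    obtain ⟨y, hy⟩ := (eventually_eventually_nhds_eq_zero hu hU hUu
      (MvPolynomial.continuous_eval P).continuousOn hP).exists
    exact eq_zero_of_eval_eq_zero_of_surjective (hasFDerivAt_id y) Function.surjective_id hy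
  have hGX : ∀ i, IsAlgebraic (Algebra.adjoin ℝ (range fun l => φ (X l))) (φ (G i)) := fun i => by
    obtain ⟨p, hp, hp0⟩ := halg i
    -- Independence of the coordinates keeps the transported `p` non-zero.
    let e := hXind.aevalEquiv
    refine ⟨(MvPolynomial.finSuccEquiv ℝ n p).map e.toRingHom, ?_, ?_⟩
    · rw [Ne, Polynomial.map_eq_zero_iff e.injective, EmbeddingLike.map_eq_zero_iff]
      exact hp.ne_zero
    · have hcomp : (algebraMap (Algebra.adjoin ℝ (range fun l => φ (X l))) F).comp e.toRingHom =
          (MvPolynomial.aeval fun l => φ (X l) : MvPolynomial (Fin n) ℝ →ₐ[ℝ] F).toRingHom := by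
        ext i <;> simp [e]
      rw [Polynomial.aeval_def, Polynomial.eval₂_map, hcomp, ← map_polynomial_eval₂_pi, hφ]
      filter_upwards [hUu] with y hy
      rw [← hp0 y hy, MvPolynomial.eval_eq_eval_mv_eval', Polynomial.eval_map]
  obtain ⟨J, hJ, hJcard, hJalg⟩ := exists_transcendenceBasis_sum hGind hGX
  let B : J → (Fin n → ℝ) → ℝ := fun j => Sum.elim G X j
  have hBφ : (fun j : J => Sum.elim (fun i => φ (G i)) (fun l => φ (X l)) (j : Fin k ⊕ Fin n)) =
      fun j => φ (B j) := by
    ext ⟨j | j, hj⟩ <;> rfl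
  rw [hBφ] at hJalg
  have hBc : ∀ j, ContinuousOn (B j) U := by
    rintro ⟨j | j, hj⟩
    exacts [hGc j, hXc j]
  -- The `Q i` will give differentiability of `g`, the `R l` injectivity of `T`; being finitely
  -- many, their conditions hold at a common point.
  choose Q hQ using fun i => exists_eventually_implicit_equation hu hU hUu hφ (hGc i) hXc (hGX i)
  choose R hR using fun l =>
    exists_eventually_implicit_equation hu hU hUu hφ (hXc l) hBc (hJalg l)
  have hall := (eventually_all.mpr hQ).and ((eventually_all.mpr hR).and hUu)
  obtain ⟨x, hQx, hRx, hxU⟩ := hall.exists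
  have hXd : ∀ l, HasFDerivAt (X l) (ContinuousLinearMap.proj l : (Fin n → ℝ) →L[ℝ] ℝ) x :=
    fun l => hasFDerivAt_apply l x
  have hGd : ∀ i, DifferentiableAt ℝ (G i) x := fun i => by
    obtain ⟨h0, h1⟩ := hQx i
    let β' : Fin n → ℝ × (Fin n → ℝ) →L[ℝ] ℝ := fun l =>
      (ContinuousLinearMap.proj l).comp (ContinuousLinearMap.snd ℝ ℝ (Fin n → ℝ))
    obtain ⟨D, hD, h2⟩ := exists_mem_span_hasFDerivAt_eval₂ (x := (G i x, x))
      (β := fun l z => z.2 l) (β' := β') (fun l => (β' l).hasFDerivAt)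
      (ContinuousLinearMap.fst ℝ ℝ (Fin n → ℝ)).hasFDerivAt (Q i)
    refine differentiableAt_of_implicit ((hGc i).continuousAt (hU.mem_nhds hxU)) h2 ?_ h0
    -- `D` involves only the coordinates of `x`, not the value.
    have hD0 : D (1, 0) = 0 := apply_eq_zero_of_mem_span (fun l => rfl) hD
    simpa [hD0] using h1
  have hgd : DifferentiableAt ℝ g x := differentiableAt_pi.mpr hGd
  have hBd : ∀ j, HasFDerivAt (B j) (fderiv ℝ (B j) x) x := by
    rintro ⟨j | j, hj⟩
    exacts [(hGd j).hasFDerivAt, (hXd j).differentiableAt.hasFDerivAt]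
  let T : (Fin n → ℝ) →ₗ[ℝ] J → ℝ := LinearMap.pi fun j => (fderiv ℝ (B j) x).toLinearMap
  have hTinj : Function.Injective T := by
    rw [injective_iff_map_eq_zero]
    intro v hv
    ext l
    obtain ⟨h0, h1⟩ := hRx l
    obtain ⟨D, hD, h2⟩ := exists_mem_span_hasFDerivAt_eval₂ hBd (hXd l) (R l)
    have h3 := h2.unique ((hasFDerivAt_const (0 : ℝ) x).congr_of_eventuallyEq h0)
    have h4 : D v = 0 := apply_eq_zero_of_mem_span (fun j => congrFun hv j) hD
    have h5 := DFunLike.congr_fun h3 v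
    simp only [add_apply, smul_apply, h4, add_zero] at h5
    exact (smul_eq_zero.mp h5).resolve_left h1
  have hTsurj : Function.Surjective T := by
    let _ : Fintype J := Fintype.ofFinite J
    have hle : Module.finrank ℝ (J → ℝ) ≤ n := by
      rw [Module.finrank_fintype_fun_eq_card, ← Nat.card_eq_fintype_card]
      have := hJcard
      rw [← J.toFinite.cast_ncard_eq, Nat.cast_le] at this
      exact this
    have hge := LinearMap.finrank_le_finrank_of_injective hTinj
    rw [Module.finrank_fin_fun] at hge
    exact (LinearMap.injective_iff_surjective_of_finrank_eq_finrank
      (by rw [Module.finrank_fin_fun]; exact le_antisymm hge hle)).mp hTinj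
  refine ⟨x, hxU, hgd, fun c => ?_⟩
  -- The added coordinates get the arbitrary value `0`.
  obtain ⟨v, hv⟩ := hTsurj fun j => Sum.elim c 0 (j : Fin k ⊕ Fin n)
  refine ⟨v, funext fun i => ?_⟩
  have hi : fderiv ℝ (G i) x = (ContinuousLinearMap.proj i).comp (fderiv ℝ g x) :=
    (hasFDerivAt_pi'.mp hgd.hasFDerivAt i).fderiv
  have h := congrFun hv ⟨Sum.inl i, hJ i⟩
  change fderiv ℝ (G i) x v = c i at h
  rwa [hi] at h

theorem eval_eq_zero_imp_iff_exists_rank {n k : ℕ} {U : Set (Fin n → ℝ)} (hU : IsOpen U)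
    {g : (Fin n → ℝ) → (Fin k → ℝ)} (hcont : ContinuousOn g U)
    (halg : ∀ i, IsAlgebraicFunOn (fun x => g x i) U) :
    (∀ P : MvPolynomial (Fin k) ℝ, (∀ x ∈ U, MvPolynomial.eval (g x) P = 0) → P = 0) ↔
      ∃ x ∈ U, DifferentiableAt ℝ g x ∧ (jacobianMatrix g x).rank = k := by
  constructor
  · intro hg
    obtain ⟨x, hx, hd, hs⟩ := exists_surjective_fderiv hU hcont halg hg
    exact ⟨x, hx, hd, (jacobianMatrix_rank_eq_iff hd).mpr hs⟩
  · rintro ⟨x, hx, hd, hr⟩ P hP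
    refine eq_zero_of_eval_eq_zero_of_surjective hd.hasFDerivAt
      ((jacobianMatrix_rank_eq_iff hd).mp hr) ?_
    filter_upwards [hU.mem_nhds hx] with y hy using hP y hy

/-! ### The three forms of independence -/

theorem algebraicIndependent_iff_eval {n k : ℕ} (U : Set (Fin n → ℝ))
    (g : (Fin n → ℝ) → (Fin k → ℝ)) :
    AlgebraicIndependent ℝ (fun (i : Fin k) (x : U) => g x i) ↔
      ∀ P : MvPolynomial (Fin k) ℝ, (∀ x ∈ U, MvPolynomial.eval (g x) P = 0) → P = 0 := by
  rw [algebraicIndependent_iff]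
  refine forall_congr' fun P => imp_congr_left ?_
  have h : ∀ x : U, MvPolynomial.aeval (fun (i : Fin k) (x : U) => g x i) P x =
      MvPolynomial.eval (g x) P := fun x => by
    exact DFunLike.congr_fun (MvPolynomial.comp_aeval (fun (i : Fin k) (x : U) => g x i)
      (Pi.evalAlgHom ℝ (fun _ : U => ℝ) x)) P
  rw [funext_iff, Subtype.forall]
  exact forall₂_congr fun x hx => by rw [h ⟨x, hx⟩]; rfl

theorem onlyTriviallyAnnihilatedIn_polynomialFuns_iff {n k : ℕ} (U : Set (Fin n → ℝ))
    (g : (Fin n → ℝ) → (Fin k → ℝ)) :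
    OnlyTriviallyAnnihilatedIn (polynomialFuns k) g U ↔
      ∀ P : MvPolynomial (Fin k) ℝ, (∀ x ∈ U, MvPolynomial.eval (g x) P = 0) → P = 0 := by
  constructor
  · intro h P hP
    have h0 := h (fun y => MvPolynomial.eval y P) ⟨P, fun _ => rfl⟩ hP
    exact MvPolynomial.funext fun y => by rw [map_zero]; exact congrFun h0 y
  · rintro h H ⟨P, hP⟩ hH
    ext y
    rw [hP, h P fun x hx => by rw [← hP, hH x hx], map_zero, Pi.zero_apply]

theorem polynomialFuns_subset_algebraicFuns (k : ℕ) : polynomialFuns k ⊆ algebraicFuns k := by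
  rintro H ⟨P, hP⟩
  let e := MvPolynomial.finSuccEquiv ℝ k
  refine ⟨e.symm (Polynomial.X - Polynomial.C P), ?_, fun y _ => ?_⟩
  · rw [MulEquiv.irreducible_iff e.symm]
    exact (Polynomial.monic_X_sub_C P).irreducible_of_degree_eq_one (Polynomial.degree_X_sub_C P)
  · rw [MvPolynomial.eval_eq_eval_mv_eval']
    simp [e, hP]

/-- Take the constant coefficient of `p` in the value variable. Were it zero, that variable would
divide the irreducible `p` with unit quotient, forcing `H = 0`. -/
theorem IsAlgebraicFunOn.exists_polynomial_of_ne_zero {k : ℕ} {H : (Fin k → ℝ) → ℝ}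
    (hH : IsAlgebraicFunOn H univ) (hH0 : H ≠ 0) :
    ∃ P : MvPolynomial (Fin k) ℝ, P ≠ 0 ∧ ∀ y, H y = 0 → MvPolynomial.eval y P = 0 := by
  obtain ⟨p, hp, hp0⟩ := hH
  let e := MvPolynomial.finSuccEquiv ℝ k
  have hev : ∀ y, ((e p).map (MvPolynomial.eval y)).eval (H y) = 0 := fun y => by
    rw [← MvPolynomial.eval_eq_eval_mv_eval', hp0 y (mem_univ y)]
  refine ⟨(e p).coeff 0, fun h0 => hH0 ?_, fun y hy => ?_⟩
  · obtain ⟨q, hq⟩ := Polynomial.X_dvd_iff.mpr h0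
    have hirr : Irreducible (e p) := (MulEquiv.irreducible_iff e).mpr hp
    have hu : IsUnit q := (hirr.isUnit_or_isUnit hq).resolve_left Polynomial.not_isUnit_X
    ext y
    have h := hev y
    rw [hq, Polynomial.map_mul, Polynomial.map_X, Polynomial.eval_mul, Polynomial.eval_X] at h
    have hu' := (hu.map (Polynomial.mapRingHom (MvPolynomial.eval y))).map
      (Polynomial.evalRingHom (H y))
    exact (mul_eq_zero.mp h).resolve_right hu'.ne_zero
  · have h := hev y
    rwa [hy, ← Polynomial.coeff_zero_eq_eval_zero, Polynomial.coeff_map] at h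

theorem onlyTriviallyAnnihilatedIn_algebraicFuns_iff {n k : ℕ} (U : Set (Fin n → ℝ))
    (g : (Fin n → ℝ) → (Fin k → ℝ)) :
    OnlyTriviallyAnnihilatedIn (algebraicFuns k) g U ↔
      ∀ P : MvPolynomial (Fin k) ℝ, (∀ x ∈ U, MvPolynomial.eval (g x) P = 0) → P = 0 := by
  constructor
  · intro h
    rw [← onlyTriviallyAnnihilatedIn_polynomialFuns_iff]
    exact fun H hH => h H (polynomialFuns_subset_algebraicFuns k hH)
  · intro h H hH hHg
    by_contra hH0
    obtain ⟨P, hP0, hP⟩ := IsAlgebraicFunOn.exists_polynomial_of_ne_zero hH hH0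
    exact hP0 (h P fun x hx => hP _ (hHg x hx))

end

theorem mainTheorem4 (m k : ℕ) (hk : k ≤ m + 1)
    (U : Set (Fin (m + 1) → ℝ)) (hU : IsOpen U)
    (g : (Fin (m + 1) → ℝ) → (Fin k → ℝ))
    (hcont : ContinuousOn g U)
    (halg : ∀ i, IsAlgebraicFunOn (fun x => g x i) U) :
    (AlgebraicIndependent ℝ (fun (i : Fin k) (x : U) => g x i) ↔
        ∃ x ∈ U, DifferentiableAt ℝ g x ∧ (jacobianMatrix g x).rank = k) ∧
      (OnlyTriviallyAnnihilatedIn (polynomialFuns k) g U ↔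
        ∃ x ∈ U, DifferentiableAt ℝ g x ∧ (jacobianMatrix g x).rank = k) ∧
      (OnlyTriviallyAnnihilatedIn (algebraicFuns k) g U ↔
        ∃ x ∈ U, DifferentiableAt ℝ g x ∧ (jacobianMatrix g x).rank = k) := by
  rw [algebraicIndependent_iff_eval, onlyTriviallyAnnihilatedIn_polynomialFuns_iff,
    onlyTriviallyAnnihilatedIn_algebraicFuns_iff]
  have h := eval_eq_zero_imp_iff_exists_rank hU hcont halg
  exact ⟨h, h, h⟩
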